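/- All graphs are finite and simple. A \emph{separator} of a graph $H$ is a pair $(A,B)$ of subsets of $V(H)$ with $A\cup B=V(H)$ such that no edge of $H$ joins a vertex of $A\setminus B$ with a vertex of $B\setminus A$; its \emph{order} is $|A\cap B|$, and it is \emph{balanced} if $|A\setminus B|\le \frac23|V(H)|$ and $|B\setminus A|\le\frac23|V(H)|$. For an integer $r\ge 0$, an \emph{$r$-minor} of a graph $G$ is any graph obtained from $G$ by contracting pairwise vertex-disjoint subgraphs of radius at most $r$ and removing vertices and edges, and $\nabla_r(G)$ is the maximum of $|E(G')|/|V(G')|$ over all $r$-minors $G'$ of $G$ with at least one vertex (with $\nabla_r(G)=0$ if $G$ has no vertices). Theorem. For all real numbers $c\ge 1$ and $0<\delta\le 1$ there exists a function $f:\{0,1,2,\dots\}\to[0,\infty)$, depending only on $c$ and $\delta$, with $f(r)=O\bigl(r^{5/\delta^2}\bigr)$ as $r\to\infty$, such that the following holds: if $G$ is a graph such that every subgraph $H$ of $G$ has a balanced separator of order at most $c|V(H)|^{1-\delta}$, then $\nabla_r(G)\le f(r)$ for every integer $r\ge 0$. -/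

import Mathlib

open Filter Asymptotics
open scoped NNReal

namespace SimpleGraph

variable {V W : Type*}

/-- `(A, B)` is a separator of `G`: the two sets cover the vertex set, and no edge of `G` joins a
vertex of `A \ B` with a vertex of `B \ A`. -/
def IsSeparator (G : SimpleGraph V) (A B : Set V) : Prop :=
  A ∪ B = Set.univ ∧ ∀ a ∈ A \ B, ∀ b ∈ B \ A, ¬ G.Adj a b

/-- A separator `(A, B)` of a finite graph `G` is balanced if `|A \ B|` and `|B \ A|` are both at
most `2 |V(G)| / 3`. -/
def IsBalancedSeparator (G : SimpleGraph V) (A B : Set V) : Prop :=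
  G.IsSeparator A B ∧
    ((A \ B).ncard : ℝ) ≤ 2 * (Nat.card V : ℝ) / 3 ∧
    ((B \ A).ncard : ℝ) ≤ 2 * (Nat.card V : ℝ) / 3

/-- Every subgraph `H` of the finite graph `G` has a balanced separator of order (the size of
`A ∩ B`) at most `c |V(H)| ^ β`. -/
def HasBalancedSeparators (G : SimpleGraph V) (c β : ℝ) : Prop :=
  ∀ H : G.Subgraph, ∃ A B : Set H.verts, H.coe.IsBalancedSeparator A B ∧
    ((A ∩ B).ncard : ℝ) ≤ c * (Nat.card H.verts : ℝ) ^ β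

/-- `H` is (isomorphic to) a `k`-minor of `G`: `H` is obtained from `G` by contracting pairwise
vertex-disjoint subgraphs of radius at most `k` and removing vertices and edges. The subgraph `S w`
is the one contracted to the vertex `w`; it is a single vertex, of radius `0`, if `w` is a vertex
of `G` that is not affected by the contractions. The bound on the radius forces `S w` to be
nonempty and connected, since `radius` is `⊤` for empty and for disconnected graphs. -/
def IsShallowMinor (k : ℕ) (H : SimpleGraph W) (G : SimpleGraph V) : Prop :=
  ∃ S : W → G.Subgraph,
    (∀ w, (S w).coe.radius ≤ (k : ℕ∞)) ∧
    (∀ u v, u ≠ v → Disjoint (S u).verts (S v).verts) ∧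
    (∀ u v, H.Adj u v → ∃ x ∈ (S u).verts, ∃ y ∈ (S v).verts, G.Adj x y)

/-- The edge densities `|E(H)| / |V(H)|` of the `k`-minors `H` of `G` with at least one vertex (a
finite graph is isomorphic to one with vertex set `Fin n`). -/
def shallowMinorDensities (k : ℕ) (G : SimpleGraph V) : Set ℝ :=
  {d | ∃ (n : ℕ) (H : SimpleGraph (Fin n)), 0 < n ∧ H.IsShallowMinor k G ∧
    d = (H.edgeSet.ncard : ℝ) / (n : ℝ)}

/-- `∇_k(G)`, the maximum edge density of a `k`-minor of the finite graph `G` (and `0` if `G` has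
no vertices). -/
noncomputable def nabla (k : ℕ) (G : SimpleGraph V) : ℝ :=
  sSup (shallowMinorDensities k G)

/-- The expansion of `G` is bounded by `f`. -/
def ExpansionBoundedBy (G : SimpleGraph V) (f : ℕ → ℝ≥0) : Prop :=
  ∀ k : ℕ, nabla k G ≤ (f k : ℝ)

theorem IsShallowMinor.card_le [Finite V] {k n : ℕ} {H : SimpleGraph (Fin n)}
    {G : SimpleGraph V} (h : H.IsShallowMinor k G) : n ≤ Nat.card V := by
  obtain ⟨S, hr, hd, -⟩ := h
  have hne : ∀ w, ∃ x, x ∈ (S w).verts := by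
    intro w
    by_contra hcon
    push Not at hcon
    have : IsEmpty (S w).verts := ⟨fun x => hcon x.1 x.2⟩
    have := hr w
    rw [radius, iInf_of_empty] at this
    exact absurd this (by simp)
  choose g hg using hne
  have hinj : Function.Injective g := by
    intro u v huv
    by_contra hne
    exact Set.disjoint_left.1 (hd u v hne) (hg u) (huv ▸ hg v)
  simpa using Nat.card_le_card_of_injective g hinj

theorem finite_shallowMinorDensities [Finite V] (k : ℕ) (G : SimpleGraph V) :
    (shallowMinorDensities k G).Finite := by
  have : (⋃ n ∈ Set.Iic (Nat.card V), Set.range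
      (fun H : SimpleGraph (Fin n) => (H.edgeSet.ncard : ℝ) / (n : ℝ))).Finite :=
    (Set.finite_Iic _).biUnion fun n _ => Set.finite_range _
  refine this.subset ?_
  rintro d ⟨n, H, -, hH, rfl⟩
  exact Set.mem_biUnion (Set.mem_Iic.2 hH.card_le) ⟨H, rfl⟩

/-- For a finite nonempty graph the supremum defining `∇_k(G)` is a maximum. -/
theorem isGreatest_nabla [Finite V] [Nonempty V] (k : ℕ) (G : SimpleGraph V) :
    IsGreatest (shallowMinorDensities k G) (nabla k G) := by
  have hfin := finite_shallowMinorDensities k G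
  refine ⟨Set.Nonempty.csSup_mem ?_ hfin, fun d hd => le_csSup hfin.bddAbove hd⟩
  obtain ⟨v⟩ := ‹Nonempty V›
  refine ⟨_, 1, ⊥, one_pos, ⟨fun _ => G.singletonSubgraph v, ?_, ?_, ?_⟩, rfl⟩
  · intro w
    have : Subsingleton (G.singletonSubgraph v).verts :=
      (Set.subsingleton_singleton (a := v)).coe_sort
    have : Nonempty (G.singletonSubgraph v).verts := ⟨⟨v, rfl⟩⟩
    refine (iInf_le _ ⟨v, rfl⟩).trans ?_
    rw [eccent_def]
    refine iSup_le fun x => ?_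
    rw [Subsingleton.elim x ⟨v, rfl⟩, edist_self]
    exact zero_le
  · intro a b hab
    exact absurd (Subsingleton.elim a b) hab
  · intro a b hab
    exact hab.elim

end SimpleGraph

/-!
A nearly regular shallow minor of large average degree is impossible by counting. Strongly sublinear
separators, applied recursively, break any set `U` of vertices of `G` into pieces of at most `s`
vertices at the cost of deleting only `O(|U| s^{-δ})` of them
(`HasBalancedSeparators.exists_shattering`). Let `H` be an `r`-minor of `G` of average degree about
`d`, on `m` vertices. A family of `L m` edges of `H`, with `L` a constant, needs only `O(r L m)`
vertices of `G` to be realized, so it is shattered in the same sense by the deletion of few vertices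
of `H` (`IsRootedModel.exists_shattering`). If the maximum degree of `H` is `O(d)`, the number of
ways to shatter is exponential in `m` with base `O(d)`, and each of them is compatible with only
a small proportion of the edges, so that not all families of `L m` edges can be shattered once `d`
exceeds a constant multiple of `r ^ (5 / δ)` (`card_darts_pow_le_of_shattering`,
`HasBalancedSeparators.exists_avgDegree_lt_of_nearly_regular`).

A general `H` is reduced to this case by star contractions. Suppose that `H` has average degree `d`
and that no induced subgraph has a larger one. Either the vertices of degree `O(d)` span a positive
proportion of the edges, which is the nearly regular case, or a positive proportion of the vertices
have `Ω(d)` neighbours in a small set `R` of vertices of large degree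
(`dense_small_or_many_to_large`).
Contract these vertices into `R` one at a time, each so as to create as many new edges in `R` as
possible. If at some point `Ω(d)` new edges are not available, a neighbourhood in `R` spans a graph
of order `Ω(d)` and of minimum degree at least half its order, which is again nearly regular.
Otherwise the outcome is a `(3 r + 1)`-minor on the much smaller vertex set `R` whose average degree
is larger by a constant factor of our choice (`exists_starContraction`). With the factor
`4 ^ (5 / δ)` this contradicts the minimality of a smallest counterexample
(`HasBalancedSeparators.exists_avgDegree_lt`). The resulting bound is `O(r ^ (5 / δ))`, and
`5 / δ ≤ 5 / δ ^ 2`.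
-/

namespace SimpleGraph

open Finset
open scoped Classical

variable {V W : Type*}

/-! ### Shattering along balanced separators -/

/-- The separator of the subgraph induced by `U`, as a partition of `U` into the separator `S` and
the two sides `P` and `Q`. -/
theorem HasBalancedSeparators.exists_partition [Finite V] {G : SimpleGraph V} {c β : ℝ}
    (h : G.HasBalancedSeparators c β) (U : Finset V) :
    ∃ S P Q : Finset V, S ⊆ U ∧ P ⊆ U ∧ Q ⊆ U ∧ (∀ u ∈ U, u ∈ S ∨ u ∈ P ∨ u ∈ Q) ∧
      Disjoint P Q ∧ (∀ p ∈ P, ∀ q ∈ Q, ¬ G.Adj p q) ∧ (#S : ℝ) ≤ c * (#U : ℝ) ^ β ∧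
      (#P : ℝ) ≤ 2 * #U / 3 ∧ (#Q : ℝ) ≤ 2 * #U / 3 := by
  obtain ⟨A, B, ⟨⟨hcov, hsep⟩, hA, hB⟩, hAB⟩ := h ((⊤ : G.Subgraph).induce U)
  have hcard : Nat.card ((⊤ : G.Subgraph).induce (U : Set V)).verts = #U := by
    simp
  rw [hcard] at hA hB hAB
  set f : ((⊤ : G.Subgraph).induce (U : Set V)).verts → V := Subtype.val with hf
  have hinj : Function.Injective f := Subtype.val_injective
  have key (T : Set ((⊤ : G.Subgraph).induce (U : Set V)).verts) :
      #(f '' T).toFinite.toFinset = T.ncard := by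
    rw [← Set.ncard_eq_toFinset_card, Set.ncard_image_of_injective _ hinj]
  have hU (T : Set ((⊤ : G.Subgraph).induce (U : Set V)).verts) :
      (f '' T).toFinite.toFinset ⊆ U := by
    intro x hx
    simp only [Set.Finite.mem_toFinset, Set.mem_image] at hx
    obtain ⟨y, -, rfl⟩ := hx
    exact y.2
  refine ⟨(f '' (A ∩ B)).toFinite.toFinset, (f '' (A \ B)).toFinite.toFinset,
    (f '' (B \ A)).toFinite.toFinset, hU _, hU _, hU _, ?_, ?_, ?_, ?_, ?_, ?_⟩
  · intro u hu
    have hx : (⟨u, hu⟩ : ((⊤ : G.Subgraph).induce (U : Set V)).verts) ∈ A ∪ B :=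
      hcov ▸ Set.mem_univ _
    simp only [Set.Finite.mem_toFinset]
    by_cases hxA : (⟨u, hu⟩ : ((⊤ : G.Subgraph).induce (U : Set V)).verts) ∈ A
    · by_cases hxB : (⟨u, hu⟩ : ((⊤ : G.Subgraph).induce (U : Set V)).verts) ∈ B
      · exact Or.inl ⟨_, ⟨hxA, hxB⟩, rfl⟩
      · exact Or.inr (Or.inl ⟨_, ⟨hxA, hxB⟩, rfl⟩)
    · exact Or.inr (Or.inr ⟨_, ⟨hx.resolve_left hxA, hxA⟩, rfl⟩)
  · rw [Finset.disjoint_left]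
    intro x hx hy
    simp only [Set.Finite.mem_toFinset, Set.mem_image] at hx hy
    obtain ⟨a, ha, rfl⟩ := hx
    obtain ⟨b, hb, hab⟩ := hy
    obtain rfl := hinj hab
    exact ha.2 hb.1
  · intro x hx y hy hadj
    simp only [Set.Finite.mem_toFinset, Set.mem_image] at hx hy
    obtain ⟨a, ha, rfl⟩ := hx
    obtain ⟨b, hb, rfl⟩ := hy
    refine hsep a ha b hb ?_
    exact ⟨a.2, b.2, hadj⟩
  · rwa [key]
  · rwa [key]
  · rwa [key]

/-- The bound `C |U| ((2s/3)^{-δ} - x^{-δ})` charges the separators found in the recursion to the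
vertices of the sets they split; these sets shrink by a factor `2/3` at each level, so that the
charges of a vertex form a geometric series. The parameter `x` is an upper bound for the size of
the current set; a set that is split has more than `s` vertices, so that the bound `2s/3 ≤ x` is
inherited by its parts. -/
theorem HasBalancedSeparators.exists_shattering_aux [Finite V] {G : SimpleGraph V} {c δ s : ℝ}
    (h : G.HasBalancedSeparators c (1 - δ)) (hc : 0 ≤ c) (hδ : 0 < δ) (hs : 0 < s) (n : ℕ) :
    ∀ (U : Finset V), #U = n → ∀ x : ℝ, (#U : ℝ) ≤ x → 2 * s / 3 ≤ x →
    ∃ Q ⊆ U, (#Q : ℝ) ≤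
        #U * (c / ((3 / 2 : ℝ) ^ δ - 1) * ((2 * s / 3) ^ (-δ) - x ^ (-δ))) ∧
      ∃ col : V → ℕ, (∀ u ∈ U \ Q, ∀ v ∈ U \ Q, G.Adj u v → col u = col v) ∧
        ∀ i, (#{u ∈ U \ Q | col u = i} : ℝ) ≤ s := by
  have hκ : 0 < (3 / 2 : ℝ) ^ δ - 1 := sub_pos.2 (Real.one_lt_rpow (by norm_num) hδ)
  set C := c / ((3 / 2 : ℝ) ^ δ - 1) with hC
  have hC0 : 0 ≤ C := div_nonneg hc hκ.le
  induction n using Nat.strong_induction_on with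
  | _ n ih =>
    intro U hU x hUx hx
    have hs3 : 0 < 2 * s / 3 := by positivity
    by_cases hUs : (#U : ℝ) ≤ s
    · refine ⟨∅, by simp, ?_, fun _ => 0, by simp, fun i => ?_⟩
      · simp only [card_empty, Nat.cast_zero]
        have := Real.rpow_le_rpow_of_nonpos hs3 hx (by linarith : -δ ≤ 0)
        have := sub_nonneg.2 this
        positivity
      · exact le_trans (by exact_mod_cast card_le_card ((filter_subset _ _).trans sdiff_subset)) hUs
    · push Not at hUs
      have hN : (0 : ℝ) < #U := hs.trans hUs
      obtain ⟨S, P, R, hSU, hPU, hRU, hcov, hdisj, hno, hS, hP, hR⟩ := h.exists_partition U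
      have hPn : #P < n := by
        rw [← hU]; have : (#P : ℝ) < #U := by linarith
        exact_mod_cast this
      have hRn : #R < n := by
        rw [← hU]; have : (#R : ℝ) < #U := by linarith
        exact_mod_cast this
      obtain ⟨QP, hQP, hQPc, colP, hcolP, hclP⟩ :=
        ih _ hPn P rfl (2 * #U / 3) hP (by linarith)
      obtain ⟨QR, hQR, hQRc, colR, hcolR, hclR⟩ :=
        ih _ hRn R rfl (2 * #U / 3) hR (by linarith)
      refine ⟨S ∪ (QP ∪ QR), union_subset hSU (union_subset (hQP.trans hPU) (hQR.trans hRU)),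
        ?_, fun v => if v ∈ P then 2 * colP v else 2 * colR v + 1, ?_, ?_⟩
      · have h1 : (#(S ∪ (QP ∪ QR)) : ℝ) ≤ #S + (#QP + #QR) := by
          exact_mod_cast (card_union_le _ _).trans (Nat.add_le_add_left (card_union_le _ _) _)
        have h2 : (#P : ℝ) + #R ≤ #U := by
          rw [← Nat.cast_add, ← card_union_of_disjoint hdisj]
          exact_mod_cast card_le_card (union_subset hPU hRU)
        set a : ℝ := (2 * s / 3) ^ (-δ)
        have h3 : (2 * (#U : ℝ) / 3) ^ (-δ) = (3 / 2 : ℝ) ^ δ * (#U : ℝ) ^ (-δ) := by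
          rw [show 2 * (#U : ℝ) / 3 = (3 / 2 : ℝ)⁻¹ * #U by ring,
            Real.mul_rpow (by norm_num) hN.le, Real.rpow_neg (by norm_num),
            Real.inv_rpow (by norm_num), inv_inv]
        have h4 : (2 * (#U : ℝ) / 3) ^ (-δ) ≤ a :=
          Real.rpow_le_rpow_of_nonpos hs3 (by linarith) (by linarith)
        have h5 : x ^ (-δ) ≤ (#U : ℝ) ^ (-δ) :=
          Real.rpow_le_rpow_of_nonpos hN hUx (by linarith)
        have h6 : (#U : ℝ) ^ (1 - δ) = #U * (#U : ℝ) ^ (-δ) := by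
          rw [sub_eq_add_neg, Real.rpow_add hN, Real.rpow_one]
        have h7 : c = C * ((3 / 2 : ℝ) ^ δ - 1) := by
          rw [hC]; field_simp
        have h8 : ((#P : ℝ) + #R) * (C * (a - (2 * (#U : ℝ) / 3) ^ (-δ))) ≤
            #U * (C * (a - (2 * (#U : ℝ) / 3) ^ (-δ))) :=
          mul_le_mul_of_nonneg_right h2 (mul_nonneg hC0 (sub_nonneg.2 h4))
        calc (#(S ∪ (QP ∪ QR)) : ℝ)
            ≤ c * (#U * (#U : ℝ) ^ (-δ)) + #U * (C * (a - (2 * (#U : ℝ) / 3) ^ (-δ))) := by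
              rw [h6] at hS; linarith
          _ = #U * (C * (a - (#U : ℝ) ^ (-δ))) := by
              rw [h3]; nth_rewrite 1 [h7]; ring
          _ ≤ #U * (C * (a - x ^ (-δ))) :=
              mul_le_mul_of_nonneg_left
                (mul_le_mul_of_nonneg_left (sub_le_sub_left h5 a) hC0) hN.le
      · intro u hu v hv hadj
        simp only [Finset.mem_sdiff, mem_union, not_or] at hu hv
        have hu' := (hcov u hu.1).resolve_left hu.2.1
        have hv' := (hcov v hv.1).resolve_left hv.2.1
        by_cases huP : u ∈ P
        · have hvR : v ∉ R := fun hvR => hno u huP v hvR hadj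
          have hvP : v ∈ P := hv'.resolve_right hvR
          simp only [huP, hvP, if_true]
          rw [hcolP u (by simp [huP, hu]) v (by simp [hvP, hv]) hadj]
        · have huR := hu'.resolve_left huP
          have hvP : v ∉ P := fun hvP => hno v hvP u huR hadj.symm
          have hvR := hv'.resolve_left hvP
          simp only [huP, hvP, if_false]
          rw [hcolR u (by simp [huR, hu]) v (by simp [hvR, hv]) hadj]
      · intro i
        have hsub : {u ∈ U \ (S ∪ (QP ∪ QR)) |
              (if u ∈ P then 2 * colP u else 2 * colR u + 1) = i} ⊆
            if i % 2 = 0 then {u ∈ P \ QP | colP u = i / 2}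
            else {u ∈ R \ QR | colR u = i / 2} := by
          intro u hu
          simp only [mem_filter, Finset.mem_sdiff, mem_union, not_or] at hu
          obtain ⟨⟨huU, huS, huP', huR'⟩, hui⟩ := hu
          by_cases huP : u ∈ P
          · rw [if_pos huP] at hui
            rw [if_pos (by lia)]
            simp only [mem_filter, Finset.mem_sdiff]
            exact ⟨⟨huP, huP'⟩, by lia⟩
          · rw [if_neg huP] at hui
            rw [if_neg (by lia)]
            simp only [mem_filter, Finset.mem_sdiff]
            exact ⟨⟨((hcov u huU).resolve_left huS).resolve_left huP, huR'⟩, by lia⟩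
        refine le_trans (Nat.cast_le.2 (card_le_card hsub)) ?_
        split_ifs
        · exact hclP _
        · exact hclR _

/-- Recursive splitting along balanced separators: deleting a set `Q` of `O(|U| s^{-δ})` vertices
breaks `U` into pieces of at most `s` vertices. The pieces are unions of components, given as the
classes of a colouring. -/
theorem HasBalancedSeparators.exists_shattering [Finite V] {G : SimpleGraph V} {c δ : ℝ}
    (h : G.HasBalancedSeparators c (1 - δ)) (hc : 0 ≤ c) (hδ : 0 < δ) {s : ℝ} (hs : 0 < s)
    (U : Finset V) :
    ∃ Q ⊆ U, (#Q : ℝ) ≤ #U * (c / ((3 / 2 : ℝ) ^ δ - 1) * (2 * s / 3) ^ (-δ)) ∧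
      ∃ col : V → ℕ, (∀ u ∈ U \ Q, ∀ v ∈ U \ Q, G.Adj u v → col u = col v) ∧
        ∀ i, (#{u ∈ U \ Q | col u = i} : ℝ) ≤ s := by
  obtain ⟨Q, hQU, hQ, hcol⟩ := h.exists_shattering_aux hc hδ hs _ U rfl
    (max #U (2 * s / 3)) (le_max_left _ _) (le_max_right _ _)
  refine ⟨Q, hQU, hQ.trans ?_, hcol⟩
  have hκ : 0 < (3 / 2 : ℝ) ^ δ - 1 := sub_pos.2 (Real.one_lt_rpow (by norm_num) hδ)
  gcongr
  exact sub_le_self _ (by positivity)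

/-! ### Rooted models of shallow minors -/

/-- A model of `H` as an `r`-minor of `G`: the branch sets `B w` are pairwise disjoint, each vertex
of `B w` is reached from the centre `ctr w` by a walk of length at most `r` inside `B w`, and
adjacent vertices of `H` have branch sets joined by an edge of `G`. Only the vertex sets of the
contracted subgraphs are recorded, since their edges may be taken from `G`. -/
structure IsRootedModel (r : ℕ) (H : SimpleGraph W) (G : SimpleGraph V) (ctr : W → V)
    (B : W → Set V) : Prop where
  ctr_mem : ∀ w, ctr w ∈ B w
  exists_walk : ∀ w, ∀ x ∈ B w, ∃ p : G.Walk (ctr w) x, p.length ≤ r ∧ ∀ z ∈ p.support, z ∈ B w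
  eq_of_mem : ∀ u v x, x ∈ B u → x ∈ B v → u = v
  exists_adj : ∀ u v, H.Adj u v → ∃ x ∈ B u, ∃ y ∈ B v, G.Adj x y

theorem IsShallowMinor.exists_isRootedModel {r : ℕ} {H : SimpleGraph W} {G : SimpleGraph V}
    (h : H.IsShallowMinor r G) : ∃ ctr B, H.IsRootedModel r G ctr B := by
  obtain ⟨S, hr, hd, hadj⟩ := h
  have hc : ∀ w, ∃ x : (S w).verts, ∀ y, (S w).coe.edist x y ≤ r := by
    intro w
    have : Nonempty (S w).verts := by
      by_contra hcon
      have : IsEmpty (S w).verts := not_nonempty_iff.1 hcon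
      have := hr w
      rw [radius_eq_top_of_isEmpty] at this
      exact absurd this (by simp)
    obtain ⟨x, hx⟩ := (S w).coe.exists_eccent_eq_radius
    exact ⟨x, (eccent_le_iff _ _).1 (hx.trans_le (hr w))⟩
  choose ctr hctr using hc
  refine ⟨fun w => ctr w, fun w => (S w).verts, fun w => (ctr w).2, ?_, ?_, hadj⟩
  · intro w x hx
    have hle := hctr w ⟨x, hx⟩
    have hne : (S w).coe.edist (ctr w) ⟨x, hx⟩ ≠ ⊤ :=
      ne_top_of_le_ne_top (ENat.natCast_ne_top r) hle
    obtain ⟨p, hp⟩ := exists_walk_of_edist_ne_top hne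
    rw [← hp] at hle
    refine ⟨p.map (S w).hom, (Walk.length_map _ _).trans_le (by exact_mod_cast hle), fun z hz => ?_⟩
    obtain ⟨y, -, rfl⟩ := List.mem_map.1 ((Walk.support_map (S w).hom p) ▸ hz)
    exact y.2
  · intro u v x hu hv
    by_contra hne
    exact Set.disjoint_left.1 (hd u v hne) hu hv

theorem IsRootedModel.mono_radius {r r' : ℕ} {H : SimpleGraph W} {G : SimpleGraph V} {ctr : W → V}
    {B : W → Set V} (h : H.IsRootedModel r G ctr B) (hle : r ≤ r') :
    H.IsRootedModel r' G ctr B :=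
  ⟨h.1, fun w x hx => (h.2 w x hx).imp fun _ hp => ⟨hp.1.trans hle, hp.2⟩, h.3, h.4⟩

theorem IsRootedModel.comap {W' : Type*} {r : ℕ} {H : SimpleGraph W} {G : SimpleGraph V}
    {ctr : W → V} {B : W → Set V} (h : H.IsRootedModel r G ctr B) {f : W' → W}
    (hf : Function.Injective f) :
    (H.comap f).IsRootedModel r G (ctr ∘ f) (B ∘ f) :=
  ⟨fun w => h.1 (f w), fun w => h.2 (f w), fun _ _ x hu hv => hf (h.3 _ _ x hu hv),
    fun _ _ huv => h.4 _ _ huv⟩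

theorem Walk.apply_eq_of_forall_adj {α : Type*} {G : SimpleGraph V} {T : Set V} {col : V → α}
    (hT : ∀ u ∈ T, ∀ v ∈ T, G.Adj u v → col u = col v) {a b : V} (p : G.Walk a b)
    (hp : ∀ z ∈ p.support, z ∈ T) : col a = col b := by
  induction p with
  | nil => rfl
  | @cons u v w huv p ih =>
    have hv : v ∈ T := hp v (by simp)
    exact (hT u (hp u (by simp)) v hv huv).trans (ih fun z hz => hp z (by simp [hz]))

/-- Shattering of a shallow minor `H`, restricted to a family `e` of its edges. The walks from the
centres to the ends of these edges span a set `U` of at most `|W| + 2 (r + 1) |ι|` vertices of `G`,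
and deleting a vertex of `U` destroys at most one branch set. -/
theorem IsRootedModel.exists_shattering {ι : Type*} [Fintype ι] [Fintype W] [Finite V] {r : ℕ}
    {H : SimpleGraph W} {G : SimpleGraph V} {ctr : W → V} {B : W → Set V}
    (hM : H.IsRootedModel r G ctr B) {c δ : ℝ} (h : G.HasBalancedSeparators c (1 - δ))
    (hc : 0 ≤ c) (hδ : 0 < δ) {s : ℝ} (hs : 0 < s) (e : ι → W × W)
    (he : ∀ i, H.Adj (e i).1 (e i).2) :
    ∃ K : Finset W, (#K : ℝ) ≤ (Fintype.card W + 2 * (r + 1) * Fintype.card ι) *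
        (c / ((3 / 2 : ℝ) ^ δ - 1) * (2 * s / 3) ^ (-δ)) ∧
      ∃ col : W → ℕ, (∀ i, (e i).1 ∈ K ∨ (e i).2 ∈ K ∨ col (e i).1 = col (e i).2) ∧
        ∀ j, (#{w | w ∉ K ∧ col w = j} : ℝ) ≤ s := by
  choose x hx y hy hxy using fun i => hM.exists_adj _ _ (he i)
  choose p hpl hp using fun i => hM.exists_walk _ _ (hx i)
  choose q hql hq using fun i => hM.exists_walk _ _ (hy i)
  have hinj : Function.Injective ctr := fun u v huv =>
    hM.eq_of_mem u v _ (hM.ctr_mem u) (huv ▸ hM.ctr_mem v)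
  set U : Finset V := univ.image ctr ∪
    univ.biUnion (fun i => (p i).support.toFinset ∪ (q i).support.toFinset) with hU
  have hctrU (w) : ctr w ∈ U := mem_union_left _ (mem_image_of_mem _ (mem_univ _))
  have hpU (i) (z) (hz : z ∈ (p i).support) : z ∈ U :=
    mem_union_right _ (mem_biUnion.2 ⟨i, mem_univ _, by simp [hz]⟩)
  have hqU (i) (z) (hz : z ∈ (q i).support) : z ∈ U :=
    mem_union_right _ (mem_biUnion.2 ⟨i, mem_univ _, by simp [hz]⟩)
  have hUcard : #U ≤ Fintype.card W + 2 * (r + 1) * Fintype.card ι := by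
    refine (card_union_le _ _).trans (Nat.add_le_add card_image_le ?_)
    refine (card_biUnion_le_card_mul _ _ (2 * (r + 1)) fun i _ => ?_).trans
      (by rw [card_univ, mul_comm])
    refine (card_union_le _ _).trans ?_
    have h1 := (p i).support.toFinset_card_le
    have h2 := (q i).support.toFinset_card_le
    rw [Walk.length_support] at h1 h2
    have := hpl i
    have := hql i
    lia
  obtain ⟨Q, hQU, hQ, col, hcol, hcl⟩ := h.exists_shattering hc hδ hs U
  have hκ : 0 < (3 / 2 : ℝ) ^ δ - 1 := sub_pos.2 (Real.one_lt_rpow (by norm_num) hδ)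
  refine ⟨univ.filter fun w => ∃ z ∈ Q, z ∈ B w, ?_, col ∘ ctr, ?_, ?_⟩
  · have hKQ : #(univ.filter fun w => ∃ z ∈ Q, z ∈ B w) ≤ #Q :=
      card_le_card_of_forall_subsingleton (fun w z => z ∈ B w)
        (fun w hw => (mem_filter.1 hw).2) fun z _ u hu v hv => hM.eq_of_mem u v z hu.2 hv.2
    refine (Nat.cast_le.2 hKQ).trans (hQ.trans ?_)
    refine mul_le_mul_of_nonneg_right (by exact_mod_cast hUcard) ?_
    exact mul_nonneg (div_nonneg hc hκ.le) (by positivity)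
  · intro i
    by_contra hcon
    push Not at hcon
    obtain ⟨hK1, hK2, hne⟩ := hcon
    simp only [mem_filter_univ, not_exists, not_and] at hK1 hK2
    apply hne
    have hT : ∀ u ∈ ((U \ Q : Finset V) : Set V), ∀ v ∈ ((U \ Q : Finset V) : Set V),
        G.Adj u v → col u = col v := fun u hu v hv => hcol u hu v hv
    have hpT (z) (hz : z ∈ (p i).support) : z ∈ ((U \ Q : Finset V) : Set V) := by
      rw [mem_coe, Finset.mem_sdiff]
      exact ⟨hpU i z hz, fun hzQ => hK1 z hzQ (hp i z hz)⟩
    have hqT (z) (hz : z ∈ (q i).support) : z ∈ ((U \ Q : Finset V) : Set V) := by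
      rw [mem_coe, Finset.mem_sdiff]
      exact ⟨hqU i z hz, fun hzQ => hK2 z hzQ (hq i z hz)⟩
    have h1 := (p i).apply_eq_of_forall_adj hT hpT
    have h2 := (q i).apply_eq_of_forall_adj hT hqT
    exact h1.trans ((hT _ (hpT _ (p i).end_mem_support) _ (hqT _ (q i).end_mem_support)
      (hxy i)).trans h2.symm)
  · intro j
    refine le_trans (Nat.cast_le.2 ?_) (hcl j)
    refine card_le_card_of_injOn ctr (fun w hw => ?_) hinj.injOn
    simp only [mem_coe, mem_filter_univ, not_exists, not_and] at hw
    simp only [mem_coe, mem_filter, Finset.mem_sdiff]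
    exact ⟨⟨hctrU w, fun hwQ => hw.1 _ hwQ (hM.ctr_mem w)⟩, hw.2⟩

/-! ### Nearly regular shallow minors -/

/-- A rooted spanning forest, as a parent function whose iterates send every vertex to the root of
its component. -/
theorem exists_parent [Fintype W] (Z : SimpleGraph W) :
    ∃ par : W → W, (∀ w, par w = w ∨ Z.Adj w (par w)) ∧
      ∀ u v, par^[Fintype.card W] u = par^[Fintype.card W] v ↔ Z.Reachable u v := by
  set root : W → W := fun w => (Z.connectedComponentMk w).out with hroot
  have hr (w) : Z.Reachable w (root w) :=
    (ConnectedComponent.exact (Quot.out_eq (Z.connectedComponentMk w))).symm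
  have hroot_eq {u v} (h : Z.Reachable u v) : root u = root v := by
    simp only [hroot, ConnectedComponent.sound h]
  have hex : ∀ w x, Z.Reachable w x →
      ∃ w', (w' = w ∨ Z.Adj w w') ∧ Z.dist w' x ≤ Z.dist w x - 1 := by
    intro w x hwx
    obtain ⟨p, hp⟩ := hwx.exists_walk_length_eq_dist
    rcases p with _ | ⟨hadj, p⟩
    · exact ⟨w, Or.inl rfl, by simp⟩
    · refine ⟨_, Or.inr hadj, ?_⟩
      rw [← hp, Walk.length_cons, Nat.add_sub_cancel]
      exact dist_le p
  choose par hpar hdist using fun w => hex w (root w) (hr w)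
  have hreach (w) : Z.Reachable w (par w) := by
    rcases hpar w with h | h
    · rw [h]
    · exact h.reachable
  have hiter (k) (w) : Z.Reachable w (par^[k] w) := by
    induction k generalizing w with
    | zero => exact Reachable.refl _
    | succ k ih => exact (hreach w).trans (ih _)
  have hidist (k) (w) : Z.dist (par^[k] w) (root w) ≤ Z.dist w (root w) - k := by
    induction k generalizing w with
    | zero => simp
    | succ k ih =>
      have h1 := ih (par w)
      rw [← hroot_eq (hreach w)] at h1
      have h2 := hdist w
      rw [Function.iterate_succ_apply]
      lia
  have hfix (w) : par^[Fintype.card W] w = root w := by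
    obtain ⟨p, hp, hlen⟩ := (hr w).exists_path_of_dist
    have h1 := hp.length_lt
    have h2 := hidist (Fintype.card W) w
    exact (((hiter _ w).symm.trans (hr w)).dist_eq_zero_iff).1 (by lia)
  refine ⟨par, hpar, fun u v => ⟨fun h => ?_, fun h => ?_⟩⟩
  · have := hiter (Fintype.card W) v
    rw [← h] at this
    exact (hiter (Fintype.card W) u).trans this.symm
  · rw [hfix, hfix, hroot_eq h]

/-- Union bound over the ways of shattering a family of `L |W|` edges: a deleted set `K` together
with the parent function of a spanning forest of the surviving edges leaves room for at most
`2 k Δ + |W| s` of the (ordered) edges, and there are at most `(2 (Δ + 1)) ^ |W|` such pairs. -/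
theorem card_darts_pow_le_of_shattering [Fintype W] (H : SimpleGraph W) {L Δ k s : ℕ}
    (hs : 1 ≤ s) (hΔ : ∀ w, H.degree w ≤ Δ)
    (hsh : ∀ e : Fin (L * Fintype.card W) → W × W, (∀ i, H.Adj (e i).1 (e i).2) →
      ∃ K : Finset W, #K ≤ k ∧ ∃ col : W → ℕ,
        (∀ i, (e i).1 ∈ K ∨ (e i).2 ∈ K ∨ col (e i).1 = col (e i).2) ∧
        ∀ j, #{w | w ∉ K ∧ col w = j} ≤ s) :
    #{p : W × W | H.Adj p.1 p.2} ^ (L * Fintype.card W) ≤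
      (2 * (Δ + 1)) ^ Fintype.card W *
        (2 * k * Δ + Fintype.card W * s) ^ (L * Fintype.card W) := by
  set m := Fintype.card W with hm
  set D : Finset (W × W) := {p : W × W | H.Adj p.1 p.2} with hD
  -- The ordered edges compatible with a code `(K, par)`; the fibres of `par^[m]` are the pieces.
  set cand : Finset W × (W → W) → Finset (W × W) := fun x =>
    D.filter fun p => p.1 ∈ x.1 ∨ p.2 ∈ x.1 ∨ x.2^[m] p.1 = x.2^[m] p.2 with hcand
  set codes : Finset (Finset W × (W → W)) :=
    (univ ×ˢ Fintype.piFinset fun w => insert w (H.neighborFinset w)).filter fun x =>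
      #x.1 ≤ k ∧ ∀ y, #{w | x.2^[m] w = y} ≤ s with hcodes
  have hcodes_card : #codes ≤ (2 * (Δ + 1)) ^ m := by
    refine (card_filter_le _ _).trans ?_
    rw [card_product, card_univ, Fintype.card_finset, Fintype.card_piFinset, mul_pow]
    refine Nat.mul_le_mul_left _ ?_
    rw [hm, ← card_univ]
    refine prod_le_pow_card _ _ _ fun w _ => (card_insert_le _ _).trans ?_
    exact Nat.succ_le_succ (hΔ w)
  have hcand_card : ∀ x ∈ codes, #(cand x) ≤ 2 * k * Δ + m * s := by
    rintro ⟨K, par⟩ hx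
    simp only [hcodes, mem_filter] at hx
    obtain ⟨-, hK, hfib⟩ := hx
    have hsub : cand (K, par) ⊆
        (K.biUnion (fun w => (H.neighborFinset w).image fun v => (w, v)) ∪
          K.biUnion (fun w => (H.neighborFinset w).image fun v => (v, w))) ∪
        univ.biUnion (fun w => ({v | par^[m] v = par^[m] w} : Finset W).image fun v => (w, v)) := by
      rintro ⟨u, v⟩ hp
      simp only [hcand, hD, mem_filter, mem_univ, true_and] at hp
      simp only [mem_union, mem_biUnion, mem_image, mem_univ, true_and, mem_filter,
        mem_neighborFinset]
      rcases hp with ⟨hadj, h | h | h⟩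
      · exact Or.inl (Or.inl ⟨u, h, v, hadj, rfl⟩)
      · exact Or.inl (Or.inr ⟨v, h, u, hadj.symm, rfl⟩)
      · exact Or.inr ⟨u, v, h.symm, rfl⟩
    refine (card_le_card hsub).trans ((card_union_le _ _).trans (Nat.add_le_add
      ((card_union_le _ _).trans ?_) ?_))
    · have h1 : #(K.biUnion fun w => (H.neighborFinset w).image fun v => (w, v)) ≤ #K * Δ :=
        card_biUnion_le_card_mul _ _ _ fun w _ => card_image_le.trans (hΔ w)
      have h2 : #(K.biUnion fun w => (H.neighborFinset w).image fun v => (v, w)) ≤ #K * Δ :=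
        card_biUnion_le_card_mul _ _ _ fun w _ => card_image_le.trans (hΔ w)
      have h3 : #K * Δ ≤ k * Δ := Nat.mul_le_mul_right _ hK
      rw [mul_assoc, two_mul]
      exact Nat.add_le_add (h1.trans h3) (h2.trans h3)
    · refine (card_biUnion_le_card_mul _ _ s fun w _ => card_image_le.trans (hfib _)).trans ?_
      rw [card_univ]
  have hcover : (Fintype.piFinset fun _ : Fin (L * m) => D) ⊆
      codes.biUnion fun x => Fintype.piFinset fun _ : Fin (L * m) => cand x := by
    intro e he
    rw [Fintype.mem_piFinset] at he
    have he' (i) : H.Adj (e i).1 (e i).2 := by simpa [hD] using he i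
    obtain ⟨K, hK, col, hedge, hcl⟩ := hsh e he'
    -- The graph of the edges of the family that survive the deletion of `K`.
    set Z : SimpleGraph W := fromRel fun u v => u ∉ K ∧ v ∉ K ∧ ∃ i, e i = (u, v) with hZ
    have hZadj {u v} (h : Z.Adj u v) : u ∉ K ∧ v ∉ K ∧ col u = col v ∧ H.Adj u v := by
      rw [hZ, fromRel_adj] at h
      rcases h with ⟨-, ⟨hu, hv, i, hi⟩ | ⟨hv, hu, i, hi⟩⟩
      · have h1 := hedge i
        have h2 := he' i
        rw [hi] at h1 h2
        exact ⟨hu, hv, (h1.resolve_left hu).resolve_left hv, h2⟩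
      · have h1 := hedge i
        have h2 := he' i
        rw [hi] at h1 h2
        exact ⟨hu, hv, ((h1.resolve_left hv).resolve_left hu).symm, h2.symm⟩
    have hwalk {u v} (p : Z.Walk u v) : u = v ∨ u ∉ K ∧ v ∉ K ∧ col u = col v := by
      induction p with
      | nil => exact Or.inl rfl
      | cons hadj p ih =>
        obtain ⟨h1, h2, h3, -⟩ := hZadj hadj
        rcases ih with rfl | ⟨h4, h5, h6⟩
        · exact Or.inr ⟨h1, h2, h3⟩
        · exact Or.inr ⟨h1, h5, h3.trans h6⟩
    obtain ⟨par, hpar, hreach⟩ := exists_parent Z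
    rw [mem_biUnion]
    refine ⟨(K, par), ?_, ?_⟩
    · simp only [hcodes, mem_filter, mem_product, mem_univ, true_and, Fintype.mem_piFinset,
        mem_insert, mem_neighborFinset]
      refine ⟨fun w => (hpar w).imp id fun h => (hZadj h).2.2.2, hK, fun y => ?_⟩
      rcases (filter (fun w => par^[m] w = y) univ).eq_empty_or_nonempty with h | ⟨w₀, hw₀⟩
      · simp [h]
      · rw [mem_filter_univ] at hw₀
        have hfib {w} (hw : par^[m] w = y) : w = w₀ ∨ w ∉ K ∧ w₀ ∉ K ∧ col w = col w₀ := by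
          obtain ⟨p⟩ := (hreach w w₀).1 (hw.trans hw₀.symm)
          exact hwalk p
        by_cases hw₀K : w₀ ∈ K
        · refine le_trans (card_le_card (t := {w₀}) fun w hw => ?_) (by simpa using hs)
          rw [mem_filter_univ] at hw
          rcases hfib hw with h | h
          · exact mem_singleton.2 h
          · exact absurd hw₀K h.2.1
        · refine le_trans (card_le_card fun w hw => ?_) (hcl (col w₀))
          rw [mem_filter_univ] at hw ⊢
          rcases hfib hw with rfl | h
          · exact ⟨hw₀K, rfl⟩
          · exact ⟨h.1, h.2.2⟩
    · rw [Fintype.mem_piFinset]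
      intro i
      simp only [hcand, mem_filter]
      refine ⟨he i, ?_⟩
      by_cases h1 : (e i).1 ∈ K
      · exact Or.inl h1
      by_cases h2 : (e i).2 ∈ K
      · exact Or.inr (Or.inl h2)
      refine Or.inr (Or.inr ((hreach _ _).2 (Adj.reachable ?_)))
      rw [hZ, fromRel_adj]
      exact ⟨(he' i).ne, Or.inl ⟨h1, h2, i, rfl⟩⟩
  have h := card_le_card hcover
  rw [Fintype.card_piFinset, prod_const, card_univ, Fintype.card_fin] at h
  refine h.trans ((card_biUnion_le_card_mul _ _ ((2 * k * Δ + m * s) ^ (L * m))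
    fun x hx => ?_).trans (Nat.mul_le_mul_right _ hcodes_card))
  rw [Fintype.card_piFinset, prod_const, card_univ, Fintype.card_fin]
  exact Nat.pow_le_pow_left (hcand_card x hx) _

/-- A nearly regular shallow minor of a graph with strongly sublinear separators has average degree
less than `(A r) ^ (5 / δ)`. The parameters of the union bound are `L > 5 / δ`, `t = d ^ (δ / 5)`
and `s = d / (2 t)`: then `2 k Δ + |W| s ≤ |W| d / t`, while `t ^ L ≥ t d` exceeds `2 (Δ + 1)`. -/
theorem HasBalancedSeparators.exists_avgDegree_lt_of_nearly_regular {c δ κ : ℝ} (hc : 0 ≤ c)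
    (hδ : 0 < δ) (hδ1 : δ ≤ 1) (hκ : 0 ≤ κ) :
    ∃ A : ℝ, 1 ≤ A ∧ ∀ (V : Type*) [Finite V] (G : SimpleGraph V),
      G.HasBalancedSeparators c (1 - δ) → ∀ (W : Type) [Fintype W] [Nonempty W]
      (H : SimpleGraph W) (r : ℕ) (ctr : W → V) (B : W → Set V), 1 ≤ r →
      H.IsRootedModel r G ctr B → ∀ d : ℝ, (∀ w, (H.degree w : ℝ) ≤ κ * d) →
      d * Fintype.card W ≤ #{p : W × W | H.Adj p.1 p.2} → d < (A * r) ^ (5 / δ) := by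
  have hq : 0 < (3 / 2 : ℝ) ^ δ - 1 := sub_pos.2 (Real.one_lt_rpow (by norm_num) hδ)
  set C := c / ((3 / 2 : ℝ) ^ δ - 1) with hC
  have hC0 : 0 ≤ C := div_nonneg hc hq.le
  set L : ℕ := ⌈5 / δ⌉₊ + 1 with hL
  have hLA : 0 ≤ 60 * κ * L * C := by positivity
  refine ⟨60 * κ * L * C + 2 * κ + 3, by linarith, ?_⟩
  intro V _ G h W _ _ H r ctr B hr hM d hdeg hd
  set A := 60 * κ * L * C + 2 * κ + 3 with hA
  by_contra! hlt
  have hr1 : (1 : ℝ) ≤ r := by exact_mod_cast hr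
  have hAr : A ≤ A * r := le_mul_of_one_le_right (by linarith) hr1
  have hd0 : 0 < d := lt_of_lt_of_le (Real.rpow_pos_of_pos (by linarith) _) hlt
  set t : ℝ := d ^ (δ / 5) with ht
  have htd : t ^ (5 / δ) = d := by
    rw [ht, ← Real.rpow_mul hd0.le, div_mul_div_comm, mul_comm, div_self (by positivity),
      Real.rpow_one]
  have htA : A * r ≤ t := by
    have := Real.rpow_le_rpow (by positivity) hlt (by positivity : 0 ≤ δ / 5)
    rwa [← Real.rpow_mul (by linarith), div_mul_div_comm, mul_comm 5 δ,
      div_self (by positivity), Real.rpow_one] at this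
  have ht3 : 2 * κ + 3 ≤ t := by linarith
  have ht1 : 1 ≤ t := by linarith
  have ht0 : 0 < t := by linarith
  have h5δ : 5 ≤ 5 / δ := by rw [le_div_iff₀ hδ]; linarith
  have hdt5 : t ^ 5 ≤ d := by
    rw [← htd, ← Real.rpow_natCast]
    exact Real.rpow_le_rpow_of_exponent_le ht1 (by exact_mod_cast h5δ)
  have hd1 : 1 ≤ d := (one_le_pow₀ ht1).trans hdt5
  set s : ℝ := d / (2 * t) with hs
  have hs1 : 1 ≤ s := by
    rw [hs, le_div_iff₀ (by positivity), one_mul]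
    calc 2 * t ≤ t * t := by gcongr; linarith
      _ = t ^ 2 := by ring
      _ ≤ t ^ 5 := pow_le_pow_right₀ ht1 (by norm_num)
      _ ≤ d := hdt5
  have hsδ : (2 * s / 3) ^ (-δ) ≤ 3 / t ^ 4 := by
    have h1 : 2 * s / 3 = d / (3 * t) := by rw [hs]; field_simp
    have h2 : d ^ δ = t ^ 5 := by
      rw [ht, ← Real.rpow_natCast, ← Real.rpow_mul hd0.le]
      congr 1
      push_cast
      ring
    have h3 : (3 * t) ^ δ ≤ 3 * t := by
      calc (3 * t) ^ δ ≤ (3 * t) ^ (1 : ℝ) :=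
            Real.rpow_le_rpow_of_exponent_le (by linarith) hδ1
        _ = 3 * t := Real.rpow_one _
    rw [h1, Real.rpow_neg (by positivity), Real.div_rpow hd0.le (by positivity), h2, inv_div]
    calc (3 * t) ^ δ / t ^ 5 ≤ 3 * t / t ^ 5 := by gcongr
      _ = 3 / t ^ 4 := by field_simp
  set m := Fintype.card W with hm
  have hm0 : 0 < m := Fintype.card_pos
  have hm0' : (0 : ℝ) < m := by exact_mod_cast hm0
  set k : ℝ := 5 * r * L * m * (C * (3 / t ^ 4)) with hk
  have hk0 : 0 ≤ k := by positivity
  have hL1 : (1 : ℝ) ≤ L := by rw [hL]; push_cast; linarith [Nat.cast_nonneg (α := ℝ) ⌈5 / δ⌉₊]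
  have hcount := H.card_darts_pow_le_of_shattering (L := L) (Δ := ⌊κ * d⌋₊) (k := ⌊k⌋₊)
    (s := ⌊s⌋₊) (Nat.one_le_floor_iff _ |>.2 hs1) (fun w => Nat.le_floor (hdeg w)) (by
      intro e he
      obtain ⟨K, hK, col, hedge, hcl⟩ := hM.exists_shattering h hc hδ (by linarith : 0 < s) e he
      refine ⟨K, Nat.le_floor (hK.trans ?_), col, hedge, fun j => Nat.le_floor (hcl j)⟩
      rw [hk]
      have h1 : (Fintype.card W + 2 * (r + 1) * Fintype.card (Fin (L * m)) : ℝ) ≤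
          5 * r * L * m := by
        rw [Fintype.card_fin, ← hm]
        push_cast
        have : (1 : ℝ) ≤ r * L := one_le_mul_of_one_le_of_one_le hr1 hL1
        have : (L : ℝ) ≤ r * L := le_mul_of_one_le_left (by linarith) hr1
        have : 1 + 2 * (r + 1) * (L : ℝ) ≤ 5 * r * L := by linarith
        calc (m + 2 * (r + 1) * (L * m) : ℝ) = (1 + 2 * (r + 1) * L) * m := by ring
          _ ≤ 5 * r * L * m := by gcongr
      gcongr)
  have hreal : (d * m) ^ (L * m) ≤ (2 * (κ * d + 1)) ^ m * (d * m / t) ^ (L * m) := by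
    have h1 : ((2 * ⌊k⌋₊ * ⌊κ * d⌋₊ + m * ⌊s⌋₊ : ℕ) : ℝ) ≤ d * m / t := by
      push_cast
      have hA3 : 60 * κ * L * C * r ≤ t ^ 3 := by
        calc 60 * κ * L * C * r ≤ A * r := by gcongr; linarith
          _ ≤ t := htA
          _ ≤ t ^ 3 := le_self_pow₀ ht1 (by norm_num)
      calc (2 * ⌊k⌋₊ * ⌊κ * d⌋₊ + m * ⌊s⌋₊ : ℝ) ≤ 2 * k * (κ * d) + m * s := by
            gcongr
            · exact Nat.floor_le hk0
            · exact Nat.floor_le (by positivity)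
            · exact Nat.floor_le (by linarith)
        _ = (60 * κ * L * C * r) * (m * d / (2 * t ^ 4)) + m * s := by
            rw [hk]; field_simp; ring
        _ ≤ t ^ 3 * (m * d / (2 * t ^ 4)) + m * s := by gcongr
        _ = d * m / t := by rw [hs]; field_simp; ring
    have h2 : ((2 * (⌊κ * d⌋₊ + 1) : ℕ) : ℝ) ≤ 2 * (κ * d + 1) := by
      push_cast
      gcongr
      exact Nat.floor_le (by positivity)
    calc (d * m) ^ (L * m) ≤ (#{p : W × W | H.Adj p.1 p.2} : ℝ) ^ (L * m) := by gcongr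
      _ ≤ ((2 * (⌊κ * d⌋₊ + 1) : ℕ) : ℝ) ^ m *
          ((2 * ⌊k⌋₊ * ⌊κ * d⌋₊ + m * ⌊s⌋₊ : ℕ) : ℝ) ^ (L * m) := by exact_mod_cast hcount
      _ ≤ _ := by gcongr
  have htL : t ^ (L * m) ≤ (2 * (κ * d + 1)) ^ m := by
    rw [div_pow, mul_div_assoc', le_div_iff₀ (by positivity), mul_comm] at hreal
    exact le_of_mul_le_mul_right hreal (by positivity)
  rw [pow_mul] at htL
  have hle : t ^ L ≤ 2 * (κ * d + 1) := le_of_pow_le_pow_left₀ hm0.ne' (by positivity) htL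
  have hge : d * t ≤ t ^ L := by
    rw [hL, pow_succ, ← Real.rpow_natCast]
    gcongr
    nth_rewrite 1 [← htd]
    exact Real.rpow_le_rpow_of_exponent_le ht1 (Nat.le_ceil _)
  have : d * (2 * κ + 3) ≤ d * t := by gcongr
  linarith [mul_nonneg hκ hd0.le]

/-! ### Star contractions -/

/-- The graph obtained by contracting each `v ∈ T` into `φ v`, keeping of the resulting edges only
those that come from an edge at a contracted vertex. -/
def starContraction (H : SimpleGraph W) (T : Finset W) (φ : W → W) : SimpleGraph W :=
  fromRel fun b b' => ∃ v ∈ T, φ v = b ∧ H.Adj v b'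

theorem starContraction_le_insert (H : SimpleGraph W) {T : Finset W} {φ : W → W} {v : W}
    (hv : v ∉ T) (b : W) :
    H.starContraction T φ ≤ H.starContraction (insert v T) (Function.update φ v b) := by
  have key {x y} (h : ∃ u ∈ T, φ u = x ∧ H.Adj u y) :
      ∃ u ∈ insert v T, Function.update φ v b u = x ∧ H.Adj u y := by
    obtain ⟨u, hu, hux, huy⟩ := h
    refine ⟨u, mem_insert_of_mem hu, ?_, huy⟩
    rwa [Function.update_of_ne (ne_of_mem_of_not_mem hu hv)]
  intro x y hxy
  rw [starContraction, fromRel_adj] at hxy ⊢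
  exact ⟨hxy.1, hxy.2.imp key key⟩

/-- A star contraction of an `r`-minor is a `(3 r + 1)`-minor: from the centre of `φ v` one reaches
the branch set of `v` through that of `φ v`, and then its farthest vertex through its centre. -/
theorem IsRootedModel.starContraction {r : ℕ} {H : SimpleGraph W} {G : SimpleGraph V} {ctr : W → V}
    {B : W → Set V} (h : H.IsRootedModel r G ctr B) {T S : Finset W} {φ : W → W}
    (hφ : ∀ v ∈ T, H.Adj v (φ v)) (hTS : Disjoint T S) :
    ((H.starContraction T φ).comap ((↑) : S → W)).IsRootedModel (3 * r + 1) G (fun b => ctr b)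
      (fun b => {x | ∃ v : W, (v = b ∨ v ∈ T ∧ φ v = b) ∧ x ∈ B v}) := by
  have key (b b' : S) (hb : ∃ v ∈ T, φ v = b ∧ H.Adj v b') :
      ∃ x, (∃ v, (v = (b : W) ∨ v ∈ T ∧ φ v = b) ∧ x ∈ B v) ∧
        ∃ y, (∃ v, (v = (b' : W) ∨ v ∈ T ∧ φ v = b') ∧ y ∈ B v) ∧ G.Adj x y := by
    obtain ⟨v, hv, hvb, hadj⟩ := hb
    obtain ⟨x, hx, y, hy, hxy⟩ := h.exists_adj _ _ hadj
    exact ⟨x, ⟨v, Or.inr ⟨hv, hvb⟩, hx⟩, y, ⟨b', Or.inl rfl, hy⟩, hxy⟩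
  refine ⟨fun b => ⟨b, Or.inl rfl, h.ctr_mem b⟩, ?_, ?_, ?_⟩
  · rintro b z ⟨v, rfl | ⟨hv, hvb⟩, hz⟩
    · obtain ⟨p, hp, hpB⟩ := h.exists_walk _ _ hz
      exact ⟨p, by lia, fun x hx => ⟨b, Or.inl rfl, hpB x hx⟩⟩
    · have hadj : H.Adj b v := hvb ▸ (hφ v hv).symm
      obtain ⟨x, hx, y, hy, hxy⟩ := h.exists_adj _ _ hadj
      obtain ⟨p, hp, hpB⟩ := h.exists_walk _ _ hx
      obtain ⟨q, hq, hqB⟩ := h.exists_walk _ _ hy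
      obtain ⟨q', hq', hqB'⟩ := h.exists_walk _ _ hz
      refine ⟨p.append (Walk.cons hxy (q.reverse.append q')), ?_, fun w hw => ?_⟩
      · simp only [Walk.length_append, Walk.length_cons, Walk.length_reverse]
        lia
      · simp only [Walk.mem_support_append_iff, Walk.support_cons, List.mem_cons,
          Walk.support_reverse, List.mem_reverse] at hw
        rcases hw with hw | rfl | hw | hw
        · exact ⟨b, Or.inl rfl, hpB w hw⟩
        · exact ⟨b, Or.inl rfl, hx⟩
        · exact ⟨v, Or.inr ⟨hv, hvb⟩, hqB w hw⟩
        · exact ⟨v, Or.inr ⟨hv, hvb⟩, hqB' w hw⟩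
  · rintro b b' x ⟨v, hv, hx⟩ ⟨v', hv', hx'⟩
    obtain rfl := h.eq_of_mem _ _ _ hx hx'
    have hT {b : S} (hb : (b : W) ∈ T) : False := Finset.disjoint_left.1 hTS hb b.2
    rcases hv with rfl | ⟨hv, hvb⟩ <;> rcases hv' with hv' | ⟨hv', hvb'⟩
    · exact Subtype.ext hv'
    · exact (hT hv').elim
    · exact (hT (hv' ▸ hv)).elim
    · exact Subtype.ext (hvb.symm.trans hvb')
  · intro b b' hadj
    rw [comap_adj, SimpleGraph.starContraction, fromRel_adj] at hadj
    rcases hadj.2 with hb | hb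
    · exact key b b' hb
    · obtain ⟨x, hx, y, hy, hxy⟩ := key b' b hb
      exact ⟨y, hy, x, hx, hxy.symm⟩

theorem card_darts_of_eq_comap {H : SimpleGraph W} {S : Finset W} {K : SimpleGraph S}
    (hK : K = H.comap ((↑) : S → W)) :
    #{p : S × S | K.Adj p.1 p.2} = #(H.interedges S S) := by
  subst hK
  refine card_bij (fun p _ => (p.1.1, p.2.1)) ?_ ?_ ?_
  · rintro ⟨a, b⟩ hab
    rw [mem_filter_univ] at hab
    exact H.mk_mem_interedges_iff.2 ⟨a.2, b.2, hab⟩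
  · rintro ⟨a, b⟩ - ⟨a', b'⟩ - hab
    simp only [Prod.mk.injEq] at hab
    exact Prod.ext (Subtype.ext hab.1) (Subtype.ext hab.2)
  · rintro ⟨a, b⟩ hab
    obtain ⟨ha, hb, hadj⟩ := H.mk_mem_interedges_iff.1 hab
    exact ⟨(⟨a, ha⟩, ⟨b, hb⟩), by simpa using hadj, rfl⟩

theorem degree_of_eq_comap {H : SimpleGraph W} {S : Finset W} {K : SimpleGraph S}
    (hK : K = H.comap ((↑) : S → W)) (w : S) : K.degree w = #{v ∈ S | H.Adj w v} := by
  subst hK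
  rw [← card_neighborFinset_eq_degree]
  refine card_bij (fun v _ => v.1) ?_ ?_ ?_
  · intro v hv
    rw [mem_neighborFinset] at hv
    exact mem_filter.2 ⟨v.2, hv⟩
  · intro a _ b _ hab
    exact Subtype.ext hab
  · intro v hv
    rw [mem_filter] at hv
    exact ⟨⟨v, hv.1⟩, by simpa using hv.2, rfl⟩

theorem card_interedges_eq_sum (H : SimpleGraph W) (S T : Finset W) :
    #(H.interedges S T) = ∑ v ∈ S, #{w ∈ T | H.Adj v w} := by
  rw [interedges_def, card_filter, sum_product]
  simp_rw [card_filter]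

/-- Contracting the vertices of `T` one at a time into neighbours in `R`: as long as each
contraction can create `g` new edges, the number of edges grows to `g |T|`. Otherwise the
neighbourhood in `R` of some `v ∈ T` already spans a graph of minimum degree at least half its
order. -/
theorem exists_starContraction (H : SimpleGraph W) (R : Finset W) {g : ℕ}
    (T : Finset W) (hT : ∀ v ∈ T, 2 * g ≤ #{b ∈ R | H.Adj v b}) :
    (∃ T' ⊆ T, ∃ φ : W → W, (∀ v ∈ T', H.Adj v (φ v)) ∧ ∃ N ⊆ R, 2 * g ≤ #N ∧
      ∀ b ∈ N, #N ≤ 2 * #{b' ∈ N | (H.starContraction T' φ).Adj b b'}) ∨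
    ∃ φ : W → W, (∀ v ∈ T, H.Adj v (φ v)) ∧
      g * #T ≤ #((H.starContraction T φ).interedges R R) := by
  induction T using Finset.induction_on with
  | empty => exact Or.inr ⟨id, by simp, by simp⟩
  | insert v T hv ih =>
    rcases ih fun u hu => hT u (mem_insert_of_mem hu) with ⟨T', hT', h⟩ | ⟨φ, hφ, hcard⟩
    · exact Or.inl ⟨T', hT'.trans (subset_insert _ _), h⟩
    set Z := H.starContraction T φ with hZ
    set N := R.filter (H.Adj v) with hN
    have hNcard : 2 * g ≤ #N := hT v (mem_insert_self _ _)
    by_cases hb : ∃ b ∈ N, g ≤ #{b' ∈ N | b' ≠ b ∧ ¬ Z.Adj b b'}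
    · obtain ⟨b, hbN, hbg⟩ := hb
      refine Or.inr ⟨Function.update φ v b, ?_, ?_⟩
      · intro u hu
        rcases mem_insert.1 hu with rfl | hu
        · rw [Function.update_self]
          exact (mem_filter.1 hbN).2
        · rw [Function.update_of_ne (ne_of_mem_of_not_mem hu hv)]
          exact hφ u hu
      · set Z' := H.starContraction (insert v T) (Function.update φ v b) with hZ'
        set New := ({b' ∈ N | b' ≠ b ∧ ¬ Z.Adj b b'} : Finset W).image fun b' => (b, b') with hNew
        have hNewcard : g ≤ #New := by
          rwa [hNew, card_image_of_injective _ (Prod.mk_right_injective b)]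
        have hdisj : Disjoint (Z.interedges R R) New := by
          rw [disjoint_right]
          intro p hp hp'
          obtain ⟨b', hb', rfl⟩ := mem_image.1 hp
          exact (mem_filter.1 hb').2.2 (Z.mk_mem_interedges_iff.1 hp').2.2
        have hsub : Z.interedges R R ∪ New ⊆ Z'.interedges R R := by
          refine union_subset ?_ ?_
          · rintro ⟨x, y⟩ hp
            obtain ⟨hx, hy, hxy⟩ := Z.mk_mem_interedges_iff.1 hp
            exact Z'.mk_mem_interedges_iff.2 ⟨hx, hy, H.starContraction_le_insert hv b hxy⟩
          · intro p hp
            obtain ⟨b', hb', rfl⟩ := mem_image.1 hp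
            obtain ⟨hb'N, hne, -⟩ := mem_filter.1 hb'
            refine Z'.mk_mem_interedges_iff.2
              ⟨(mem_filter.1 hbN).1, (mem_filter.1 hb'N).1, ?_⟩
            rw [hZ', starContraction, fromRel_adj]
            exact ⟨hne.symm, Or.inl ⟨v, mem_insert_self _ _, Function.update_self _ _ _,
              (mem_filter.1 hb'N).2⟩⟩
        have := card_le_card hsub
        rw [card_union_of_disjoint hdisj] at this
        rw [card_insert_of_notMem hv, mul_add, mul_one]
        lia
    · push Not at hb
      refine Or.inl ⟨T, subset_insert _ _, φ, hφ, N, filter_subset _ _, hNcard, fun b hbN => ?_⟩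
      have h1 := hb b hbN
      have h2 : N ⊆ {b' ∈ N | Z.Adj b b'} ∪ ({b' ∈ N | b' ≠ b ∧ ¬ Z.Adj b b'} ∪ {b}) := by
        intro x hx
        simp only [mem_union, mem_filter, mem_singleton]
        tauto
      have h3 := (card_le_card h2).trans ((card_union_le _ _).trans
        (Nat.add_le_add_left (card_union_le _ _) _))
      rw [card_singleton] at h3
      lia

/-- Let the average degree `ρ` of `H` be largest among its induced subgraphs, and let `R` be the set
of vertices of degree more than `κ ρ`. Either the vertices outside `R` span a quarter of the edges,
or at least `3/8` of all vertices lie outside `R` and have at least `ρ / 8` neighbours in `R`. The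
latter holds since these vertices and `R`, which is small, then span many edges, and at most `ρ / 2`
per vertex. -/
theorem dense_small_or_many_to_large [Fintype W] (H : SimpleGraph W) {ρ κ : ℝ} (hρ : 0 < ρ)
    (hκ : 16 ≤ κ) (hW : (#(H.interedges univ univ) : ℝ) = ρ * Fintype.card W)
    (hsub : ∀ S : Finset W, (#(H.interedges S S) : ℝ) ≤ ρ * #S) :
    ∃ R : Finset W, κ * #R ≤ Fintype.card W ∧ (∀ v ∉ R, (H.degree v : ℝ) ≤ κ * ρ) ∧
      (ρ / 4 * Fintype.card W ≤ #(H.interedges Rᶜ Rᶜ) ∨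
        ∃ T : Finset W, Disjoint T R ∧ (3 / 8 : ℝ) * Fintype.card W ≤ #T ∧
          ∀ v ∈ T, ρ / 8 ≤ #{b ∈ R | H.Adj v b}) := by
  set m := Fintype.card W with hm
  set R : Finset W := {v | κ * ρ < H.degree v} with hR
  have hdeg (v) : H.degree v = #{w | H.Adj v w} := by
    rw [← card_neighborFinset_eq_degree, neighborFinset_eq_filter]
  have hRcard : κ * #R ≤ m := by
    have h1 : #R * (κ * ρ) ≤ ρ * m := by
      rw [← hW, card_interedges_eq_sum, ← nsmul_eq_mul]
      push_cast
      calc #R • (κ * ρ) ≤ ∑ v ∈ R, (#{w | H.Adj v w} : ℝ) := by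
            refine card_nsmul_le_sum _ _ _ fun v hv => ?_
            rw [← hdeg]
            exact (mem_filter.1 hv).2.le
        _ ≤ ∑ v, (#{w | H.Adj v w} : ℝ) :=
            sum_le_sum_of_subset_of_nonneg (subset_univ _) fun _ _ _ => by positivity
    refine le_of_mul_le_mul_left (a := ρ) ?_ hρ
    linarith
  refine ⟨R, hRcard, fun v hv => by simpa [hR] using hv, ?_⟩
  by_cases hSS : ρ / 4 * m ≤ #(H.interedges Rᶜ Rᶜ)
  · exact Or.inl hSS
  refine Or.inr ⟨Rᶜ.filter fun v => ρ / 8 ≤ #{b ∈ R | H.Adj v b}, ?_, ?_, ?_⟩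
  · exact Finset.disjoint_left.2 fun v hv => mem_compl.1 (mem_filter.1 hv).1
  · set T := Rᶜ.filter fun v => ρ / 8 ≤ #{b ∈ R | H.Adj v b} with hT
    have hTR : Disjoint T R := Finset.disjoint_left.2 fun v hv => mem_compl.1 (mem_filter.1 hv).1
    have : Std.Symm H.Adj := ⟨fun _ _ h => h.symm⟩
    have hcomm (S S' : Finset W) : #(H.interedges S S') = #(H.interedges S' S) :=
      Rel.card_interedges_comm S S'
    have hright (S S' S'' : Finset W) (hd : Disjoint S' S'') :
        #(H.interedges S (S' ∪ S'')) = #(H.interedges S S') + #(H.interedges S S'') := by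
      rw [hcomm, hcomm S S', hcomm S S'', card_interedges_eq_sum, card_interedges_eq_sum,
        card_interedges_eq_sum, sum_union hd]
    have hunion (S S' : Finset W) (hd : Disjoint S S') : #(H.interedges (S ∪ S') (S ∪ S')) =
        #(H.interedges S S) + 2 * #(H.interedges S S') + #(H.interedges S' S') := by
      rw [hright _ _ _ hd, hcomm _ S, hcomm _ S', hright _ _ _ hd, hright _ _ _ hd, hcomm S' S]
      ring
    have h1 := hunion Rᶜ R disjoint_compl_left
    rw [show Rᶜ ∪ R = univ by rw [union_comm, union_compl]] at h1
    have h2 : #(H.interedges Rᶜ R) ≤ #(H.interedges T R) + ρ / 8 * m := by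
      rw [card_interedges_eq_sum, ← sum_filter_add_sum_filter_not Rᶜ
        (fun v => ρ / 8 ≤ #{b ∈ R | H.Adj v b}), card_interedges_eq_sum]
      push_cast
      refine add_le_add_right ?_ _
      calc ∑ v ∈ Rᶜ with ¬ ρ / 8 ≤ #{b ∈ R | H.Adj v b}, (#{b ∈ R | H.Adj v b} : ℝ)
          ≤ #({v ∈ Rᶜ | ¬ ρ / 8 ≤ #{b ∈ R | H.Adj v b}}) • (ρ / 8) :=
            sum_le_card_nsmul _ _ _ fun v hv => (not_le.1 (mem_filter.1 hv).2).le
        _ ≤ ρ / 8 * m := by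
            rw [nsmul_eq_mul, mul_comm]
            gcongr
            exact card_le_univ _
    have h3 := hunion T R hTR
    have h4 := hsub (T ∪ R)
    rw [card_union_of_disjoint hTR] at h4
    have h5 := hsub R
    have h6 : (#R : ℝ) ≤ m / 16 := by
      have : (16 : ℝ) * #R ≤ κ * #R := mul_le_mul_of_nonneg_right hκ (Nat.cast_nonneg _)
      linarith only [this, hRcard]
    have h7 : ρ * #R ≤ ρ * (m / 16) := mul_le_mul_of_nonneg_left h6 hρ.le
    have h1' : (#(H.interedges univ univ) : ℝ) = #(H.interedges Rᶜ Rᶜ) +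
      2 * #(H.interedges Rᶜ R) + #(H.interedges R R) := by exact_mod_cast h1
    have h3' : (#(H.interedges (T ∪ R) (T ∪ R)) : ℝ) = #(H.interedges T T) +
      2 * #(H.interedges T R) + #(H.interedges R R) := by exact_mod_cast h3
    push_cast at h4
    have h8 : (0 : ℝ) ≤ #(H.interedges T T) := by positivity
    have h9 : (0 : ℝ) ≤ #(H.interedges R R) := by positivity
    refine le_of_mul_le_mul_left (a := ρ) ?_ hρ
    push Not at hSS
    linarith only [hSS, hW, h1', h2, h3', h4, h5, h7, h8, h9]
  · exact fun v hv => (mem_filter.1 hv).2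

/-! ### The density of shallow minors -/

/-- In a minimal counterexample the average degree is largest among the induced subgraphs. Neither
do its vertices of low degree span a dense graph, nor does a star contraction produce a nearly
regular dense `(3 r + 1)`-minor, so that a star contraction produces a smaller `(3 r + 1)`-minor whose average degree is larger by a
factor `4 ^ (5 / δ)`, which makes up for the increase of the depth from `r` to `3 r + 1 ≤ 4 r`. -/
theorem HasBalancedSeparators.exists_avgDegree_lt {c δ : ℝ} (hc : 0 ≤ c) (hδ : 0 < δ)
    (hδ1 : δ ≤ 1) :
    ∃ A : ℝ, 1 ≤ A ∧ ∀ (V : Type*) [Finite V] (G : SimpleGraph V),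
      G.HasBalancedSeparators c (1 - δ) → ∀ (n : ℕ) (W : Type) [Fintype W] [Nonempty W]
      (H : SimpleGraph W) (r : ℕ) (ctr : W → V) (B : W → Set V), Fintype.card W = n → 1 ≤ r →
      H.IsRootedModel r G ctr B →
      (#{p : W × W | H.Adj p.1 p.2} : ℝ) < (A * r) ^ (5 / δ) * Fintype.card W := by
  set a := 5 / δ with ha
  have ha5 : 5 ≤ a := by rw [ha, le_div_iff₀ hδ]; linarith
  -- `86 > 256 / 3`, where `3 κ / 256` is the gain in average degree of a star contraction.
  set κ : ℝ := 86 * 4 ^ a with hκ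
  have h4a : (1 : ℝ) ≤ 4 ^ a := Real.one_le_rpow (by norm_num) (by linarith)
  have hκ86 : 86 ≤ κ := by linarith
  obtain ⟨A, hA, hreg⟩ := exists_avgDegree_lt_of_nearly_regular hc hδ hδ1
    (by linarith : 0 ≤ 4 * κ)
  have hA0 : 0 ≤ A := by linarith
  refine ⟨128 * A, by linarith, ?_⟩
  intro V _ G h n
  induction n using Nat.strong_induction_on with
  | _ n ih =>
    intro W _ _ H r ctr B hn hr hM
    by_contra! hlt
    have hr1 : (1 : ℝ) ≤ r := by exact_mod_cast hr
    have hm0 : (0 : ℝ) < Fintype.card W := by exact_mod_cast Fintype.card_pos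
    -- Nearly regular minors at depth `3 r + 1 ≤ 4 r` have average degree below `ρ / 32`.
    have h128 : 32 * (4 * A * r) ^ a ≤ (128 * A * r) ^ a := by
      have h1 : (32 : ℝ) ≤ 32 ^ a := by
        simpa using Real.rpow_le_rpow_of_exponent_le (by norm_num : (1 : ℝ) ≤ 32)
          (by linarith : 1 ≤ a)
      rw [show 128 * A * r = 32 * (4 * A * r) by ring,
        Real.mul_rpow (x := 32) (by norm_num) (by positivity)]
      exact mul_le_mul_of_nonneg_right h1 (by positivity)
    set ρ : ℝ := #{p : W × W | H.Adj p.1 p.2} / Fintype.card W with hρ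
    have hRρ : (128 * A * r) ^ a ≤ ρ := (le_div_iff₀ hm0).2 hlt
    have hone : (1 : ℝ) ≤ (4 * A * r) ^ a := by
      have : 1 ≤ A * r := one_le_mul_of_one_le_of_one_le hA hr1
      exact Real.one_le_rpow (by linarith) (by linarith)
    have hρ32 : 32 ≤ ρ := by linarith
    have hρ0 : 0 < ρ := by linarith
    have hH : #(H.interedges univ univ) = #{p : W × W | H.Adj p.1 p.2} := by
      rw [interedges_def, univ_product_univ]
    have hHρ : (#(H.interedges univ univ) : ℝ) = ρ * Fintype.card W := by
      rw [hH, hρ, div_mul_cancel₀ _ hm0.ne']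
    -- Proper induced subgraphs are smaller `r`-minors, so they have average degree below
    -- `(128 A r) ^ a ≤ ρ`.
    have hsub : ∀ S : Finset W, (#(H.interedges S S) : ℝ) ≤ ρ * #S := by
      intro S
      rcases S.eq_empty_or_nonempty with rfl | hS
      · simp
      by_cases hSu : S = univ
      · rw [hSu, hHρ, card_univ]
      · have hlt' : #S < n := hn ▸ card_lt_univ_of_notMem
          (not_forall.1 fun hx => hSu (eq_univ_of_forall hx)).choose_spec
        have : Nonempty S := hS.coe_sort
        have h1 := ih (#S) hlt' S (H.comap (↑)) r _ _ (Fintype.card_coe S) hr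
          (hM.comap Subtype.val_injective)
        rw [card_darts_of_eq_comap (H := H) (S := S) rfl, Fintype.card_coe] at h1
        exact h1.le.trans (mul_le_mul_of_nonneg_right hRρ (Nat.cast_nonneg _))
    have hr4 : A * (3 * r + 1 : ℕ) ≤ 4 * A * r := by
      push_cast
      have : A * (3 * r + 1) ≤ A * (4 * r) := by gcongr; linarith
      linarith
    have hlow : (A * (3 * r + 1 : ℕ)) ^ a ≤ ρ / 32 :=
      (Real.rpow_le_rpow (by positivity) hr4 (by linarith)).trans (by linarith)
    -- At depth `r` the weaker bound `ρ / 4` suffices.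
    have hlow' : (A * r) ^ a ≤ ρ / 4 := by
      have : (A * r) ^ a ≤ (4 * A * r) ^ a :=
        Real.rpow_le_rpow (by positivity) (by nlinarith) (by linarith)
      linarith
    obtain ⟨R, hR, hdeg, hsmall | ⟨T, hTR, hTcard, hT⟩⟩ :=
      H.dense_small_or_many_to_large (κ := κ) hρ0 (by linarith) hHρ hsub
    -- The vertices of degree at most `κ ρ` span a nearly regular graph.
    · have hne : (Rᶜ).Nonempty := by
        rw [nonempty_iff_ne_empty]
        intro he
        rw [he, interedges_empty_left, card_empty, Nat.cast_zero] at hsmall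
        have : 0 < ρ / 4 * Fintype.card W := mul_pos (by linarith) hm0
        linarith
      have : Nonempty (Rᶜ : Finset W) := hne.coe_sort
      have h1 := hreg V G h (Rᶜ : Finset W) (H.comap (↑)) r _ _ hr
        (hM.comap Subtype.val_injective) (ρ / 4) (fun w => ?_) ?_
      · linarith
      · rw [degree_of_eq_comap (H := H) (S := Rᶜ) rfl]
        have h2 : #{v ∈ Rᶜ | H.Adj w v} ≤ H.degree w := by
          rw [← card_neighborFinset_eq_degree, neighborFinset_eq_filter]
          exact card_le_card (filter_subset_filter _ (subset_univ _))
        have h3 := hdeg w (mem_compl.1 w.2)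
        have h4 : (#{v ∈ Rᶜ | H.Adj w v} : ℝ) ≤ H.degree w := by exact_mod_cast h2
        linarith
      · rw [card_darts_of_eq_comap (H := H) (S := Rᶜ) rfl, Fintype.card_coe]
        refine le_trans (mul_le_mul_of_nonneg_left ?_ (by linarith)) hsmall
        exact_mod_cast card_le_univ Rᶜ
    set g : ℕ := ⌊ρ / 16⌋₊ with hg
    have hg1 : ρ / 32 ≤ g := by
      have := Nat.lt_floor_add_one (ρ / 16)
      linarith
    have hg2 : (g : ℝ) ≤ ρ / 16 := Nat.floor_le (by linarith)
    rcases H.exists_starContraction R (g := g) T (fun v hv => by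
      have h1 := hT v hv
      have h2 : (2 * g : ℝ) ≤ #{b ∈ R | H.Adj v b} := by linarith
      exact_mod_cast h2) with ⟨T', hT', φ, hφ, N, hNR, hgN, hN⟩ | ⟨φ, hφ, hcard⟩
    -- A star contraction contains a graph on `N` with all degrees between `#N / 2` and `#N`.
    · have hgN' : (2 * g : ℝ) ≤ #N := by exact_mod_cast hgN
      have hne : N.Nonempty := by
        rw [← card_pos]
        have : (0 : ℝ) < #N := by linarith
        exact_mod_cast this
      have : Nonempty N := hne.coe_sort
      have h1 := hreg V G h N ((H.starContraction T' φ).comap (↑)) (3 * r + 1) _ _ (by lia)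
        (hM.starContraction hφ (disjoint_of_subset_left hT' (disjoint_of_subset_right hNR hTR)))
        (#N / 2) (fun w => ?_) ?_
      · linarith
      · rw [degree_of_eq_comap (H := H.starContraction T' φ) (S := N) rfl]
        have h2 : (#{v ∈ N | (H.starContraction T' φ).Adj w v} : ℝ) ≤ #N := by
          exact_mod_cast card_filter_le _ _
        have h3 : (1 : ℝ) * #N ≤ 2 * κ * #N :=
          mul_le_mul_of_nonneg_right (by linarith) (Nat.cast_nonneg _)
        linarith
      · rw [card_darts_of_eq_comap (H := H.starContraction T' φ) (S := N) rfl, Fintype.card_coe,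
          card_interedges_eq_sum]
        push_cast
        calc (#N / 2 * #N : ℝ) = #N • (#N / 2 : ℝ) := by rw [nsmul_eq_mul, mul_comm]
          _ ≤ _ := card_nsmul_le_sum _ _ _ fun b hb => by
            have h2 : (#N : ℝ) ≤ 2 * #{b' ∈ N | (H.starContraction T' φ).Adj b b'} := by
              exact_mod_cast hN b hb
            linarith
    -- The star contraction onto `R` has average degree at least `(3 κ / 256) ρ > 4 ^ a ρ`.
    · have hcard' : (g * #T : ℝ) ≤ #((H.starContraction T φ).interedges R R) := by
        exact_mod_cast hcard
      have hgT : ρ / 32 * (3 / 8 * Fintype.card W) ≤ g * #T :=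
        mul_le_mul hg1 hTcard (mul_nonneg (by norm_num) hm0.le) (Nat.cast_nonneg _)
      have hne : R.Nonempty := by
        rw [nonempty_iff_ne_empty]
        intro he
        rw [he, interedges_empty_left, card_empty, Nat.cast_zero] at hcard'
        have : 0 < ρ / 32 * (3 / 8 * (Fintype.card W : ℝ)) :=
          mul_pos (by linarith) (mul_pos (by norm_num) hm0)
        linarith
      have : Nonempty R := hne.coe_sort
      have hR0 : (0 : ℝ) < #R := by exact_mod_cast hne.card_pos
      have hRn : #R < n := by
        have h1 : (86 : ℝ) * #R ≤ κ * #R := mul_le_mul_of_nonneg_right hκ86 hR0.le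
        have : (#R : ℝ) < n := by rw [← hn]; linarith
        exact_mod_cast this
      have h1 := ih (#R) hRn R ((H.starContraction T φ).comap (↑)) (3 * r + 1) _ _
        (Fintype.card_coe R) (by lia) (hM.starContraction hφ hTR)
      rw [card_darts_of_eq_comap (H := H.starContraction T φ) (S := R) rfl, Fintype.card_coe] at h1
      have h2 : (128 * A * (3 * r + 1 : ℕ)) ^ a ≤ 4 ^ a * ρ := by
        calc (128 * A * (3 * r + 1 : ℕ)) ^ a ≤ (4 * (128 * A * r)) ^ a :=
              Real.rpow_le_rpow (by positivity) (by linarith) (by linarith)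
          _ = 4 ^ a * (128 * A * r) ^ a := Real.mul_rpow (by norm_num) (by positivity)
          _ ≤ 4 ^ a * ρ := mul_le_mul_of_nonneg_left hRρ (by linarith)
      have h3 : (128 * A * (3 * r + 1 : ℕ)) ^ a * #R ≤ 4 ^ a * ρ * #R :=
        mul_le_mul_of_nonneg_right h2 hR0.le
      have h4 : ρ * (κ * #R) ≤ ρ * Fintype.card W := mul_le_mul_of_nonneg_left hR hρ0.le
      have h5 : ρ * (κ * #R) = 86 * (4 ^ a * ρ * #R) := by rw [hκ]; ring
      have h6 : 0 < 4 ^ a * ρ * #R := mul_pos (mul_pos (by linarith) hρ0) hR0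
      linarith

theorem ncard_edgeSet_le_card_darts [Fintype W] (H : SimpleGraph W) :
    H.edgeSet.ncard ≤ #{p : W × W | H.Adj p.1 p.2} := by
  have hsub : H.edgeSet ⊆
      (({p : W × W | H.Adj p.1 p.2} : Finset (W × W)).image fun p => s(p.1, p.2) :
        Finset (Sym2 W)) := by
    intro e he
    induction e with
    | _ x y =>
      rw [mem_coe, mem_image]
      exact ⟨(x, y), by simpa using he, rfl⟩
  refine (Set.ncard_le_ncard hsub (Finset.finite_toSet _)).trans ?_
  rw [Set.ncard_coe_finset]
  exact card_image_le

/-- The depth is replaced by `max k 1` since the power of `r` vanishes at `r = 0`. -/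
theorem HasBalancedSeparators.exists_nabla_le {c δ : ℝ} (hc : 0 ≤ c) (hδ : 0 < δ) (hδ1 : δ ≤ 1) :
    ∃ A : ℝ, 1 ≤ A ∧ ∀ (V : Type*) [Finite V] (G : SimpleGraph V),
      G.HasBalancedSeparators c (1 - δ) → ∀ k : ℕ,
      nabla k G ≤ (A * (max k 1 : ℕ)) ^ (5 / δ) := by
  obtain ⟨A, hA, hbound⟩ := HasBalancedSeparators.exists_avgDegree_lt hc hδ hδ1
  refine ⟨A, hA, fun V _ G h k => Real.sSup_le ?_ (by positivity)⟩
  rintro d ⟨n, H, hn, hH, rfl⟩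
  have : Nonempty (Fin n) := ⟨⟨0, hn⟩⟩
  obtain ⟨ctr, B, hM⟩ := hH.exists_isRootedModel
  have h1 := hbound V G h _ (Fin n) H (max k 1) ctr B rfl (le_max_right _ _)
    (hM.mono_radius (le_max_left _ _))
  have h2 : (H.edgeSet.ncard : ℝ) ≤ #{p : Fin n × Fin n | H.Adj p.1 p.2} := by
    exact_mod_cast H.ncard_edgeSet_le_card_darts
  rw [Fintype.card_fin] at h1
  rw [div_le_iff₀ (by exact_mod_cast hn)]
  linarith

end SimpleGraph

theorem theorem2 (c δ : ℝ) (hc : 1 ≤ c) (hδ0 : 0 < δ) (hδ1 : δ ≤ 1) :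
    ∃ f : ℕ → ℝ≥0,
      ((fun r : ℕ => (f r : ℝ)) =O[atTop] fun r : ℕ => (r : ℝ) ^ (5 / δ ^ 2)) ∧
      ∀ (V : Type*) [Finite V] (G : SimpleGraph V),
        G.HasBalancedSeparators c (1 - δ) → G.ExpansionBoundedBy f := by
  obtain ⟨A, hA, hbound⟩ :=
    SimpleGraph.HasBalancedSeparators.exists_nabla_le (by linarith : 0 ≤ c) hδ0 hδ1
  refine ⟨fun r => Real.toNNReal ((A * (max r 1 : ℕ)) ^ (5 / δ)), ?_, fun V _ G h k => ?_⟩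
  · refine IsBigO.of_bound (A ^ (5 / δ)) ?_
    filter_upwards [eventually_ge_atTop 1] with r hr
    have hr1 : (1 : ℝ) ≤ r := by exact_mod_cast hr
    rw [max_eq_left hr, Real.coe_toNNReal _ (by positivity), Real.norm_of_nonneg (by positivity),
      Real.norm_of_nonneg (by positivity), Real.mul_rpow (by linarith) (by linarith)]
    gcongr
    -- What remains is `δ ^ 2 ≤ δ`, which compares the exponents `5 / δ` and `5 / δ ^ 2`.
    nlinarith
  · rw [Real.coe_toNNReal _ (by positivity)]
    exact hbound V G h k
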